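/- A \emph{quotient Borel space} is a pair $(X,E)$, where $X$ is a standard Borel space and $E$ is a countable Borel equivalence relation on $X$ (that is, $E$ is a Borel subset of $X\times X$ and every $E$-class is countable). Its underlying set is $X/E$; let $\pi_E:X\to X/E$ be the projection. A subset $A\subseteq X/E$ is \emph{Borel} if $\pi_E^{-1}[A]$ is Borel in $X$. The product of finitely many quotient Borel spaces $(X_1,E_1),\dots,(X_n,E_n)$, $n\ge 0$, is $(X_1\times\dots\times X_n,\,E_1\times\dots\times E_n)$, where two points are equivalent iff they are equivalent in each coordinate; its underlying set is identified with $X_1/E_1\times\dots\times X_n/E_n$. A function $f:X/E\to Y/F$ is a \emph{Borel function} $(X,E)\to(Y,F)$ if its graph is a Borel subset of the product $(X,E)\times(Y,F)$, i.e. if $\{(x,y)\in X\times Y : f(\pi_E(x))=\pi_F(y)\}$ is Borel in $X\times Y$. A \emph{lifting} of $f$ is a function $\tilde f:X\to Y$ with $\pi_F\circ\tilde f=f\circ\pi_E$. \textbf{Lemma.} (1) (Existence of liftings) Let $(X,E)$ and $(Y,F)$ be quotient Borel spaces. A function $f:X/E\to Y/F$ is a Borel function $(X,E)\to(Y,F)$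 if and only if it has a Borel lifting $\tilde f:X\to Y$. (2) Identity functions are Borel and the composition of two Borel functions between quotient Borel spaces is Borel: quotient Borel spaces and Borel functions form a concrete category, with underlying sets $X/E$. (3) This category has finite products. More precisely, given $(X_1,E_1),\dots,(X_n,E_n)$, each projection $\mathrm{proj}_i:(X_1,E_1)\times\dots\times(X_n,E_n)\to(X_i,E_i)$ is Borel; for every quotient Borel space $(Y,F)$ and all Borel functions $f_i:(Y,F)\to(X_i,E_i)$ the tuple $(f_1,\dots,f_n)$ is a Borel function $(Y,F)\to(X_1,E_1)\times\dots\times(X_n,E_n)$; and the product together with these projections is the categorical product. -/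

import Mathlib

open CategoryTheory CategoryTheory.Limits

universe u v w

/-- A quotient Borel space `(X, E)`: a standard Borel space `X` with a countable Borel equivalence
relation `E` on it, i.e. `E` is Borel as a subset of `X × X` and all its classes are countable. -/
structure QuotientBorelSpace : Type (u + 1) where
  carrier : Type u
  [measurableSpace : MeasurableSpace carrier]
  [standardBorelSpace : StandardBorelSpace carrier]
  rel : Setoid carrier
  measurableSet_rel : MeasurableSet {p : carrier × carrier | rel p.1 p.2}
  countable_class : ∀ x : carrier, {y : carrier | rel x y}.Countable

namespace QuotientBorelSpace

attribute [instance] measurableSpace standardBorelSpace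

/-- The underlying set `X / E` of `(X, E)`. -/
abbrev Quot (A : QuotientBorelSpace.{u}) : Type u := Quotient A.rel

/-- The quotient projection `X → X / E`. -/
def toQuot (A : QuotientBorelSpace.{u}) (x : A.carrier) : A.Quot := Quotient.mk A.rel x

/-- Borel subsets of `(X, E)`: those whose preimage under the projection is Borel in `X`. -/
def IsBorelSet (A : QuotientBorelSpace.{u}) (S : Set A.Quot) : Prop :=
  MeasurableSet (A.toQuot ⁻¹' S)

/-- The binary product `(X × Y, E × F)`. -/
def prod (A : QuotientBorelSpace.{u}) (B : QuotientBorelSpace.{v}) :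
    QuotientBorelSpace.{max u v} where
  carrier := A.carrier × B.carrier
  rel := A.rel.prod B.rel
  measurableSet_rel := by
    have h1 : Measurable fun p : (A.carrier × B.carrier) × (A.carrier × B.carrier) =>
        (p.1.1, p.2.1) := by fun_prop
    have h2 : Measurable fun p : (A.carrier × B.carrier) × (A.carrier × B.carrier) =>
        (p.1.2, p.2.2) := by fun_prop
    exact (h1 A.measurableSet_rel).inter (h2 B.measurableSet_rel)
  countable_class := fun x => (A.countable_class x.1).prod (B.countable_class x.2)

/-- The identification of the underlying set of the product with the product of the underlying
sets; it sends the class of `(x, y)` to the pair of the class of `x` and the class of `y`. -/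
def prodEquiv (A : QuotientBorelSpace.{u}) (B : QuotientBorelSpace.{v}) :
    (A.prod B).Quot ≃ A.Quot × B.Quot :=
  (Setoid.prodQuotientEquiv A.rel B.rel).symm

/-- Borel binary relations between `(X, E)` and `(Y, F)`: Borel subsets of the product
`(X, E) × (Y, F)`. -/
def IsBorelRel (A : QuotientBorelSpace.{u}) (B : QuotientBorelSpace.{v})
    (R : Set (A.Quot × B.Quot)) : Prop :=
  (A.prod B).IsBorelSet (A.prodEquiv B ⁻¹' R)

/-- A function `X / E → Y / F` is Borel if its graph is a Borel subset of `(X, E) × (Y, F)`. -/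
def IsBorelFun {A : QuotientBorelSpace.{u}} {B : QuotientBorelSpace.{v}}
    (f : A.Quot → B.Quot) : Prop :=
  IsBorelRel A B {p | f p.1 = p.2}

theorem isBorelFun_iff {A : QuotientBorelSpace.{u}} {B : QuotientBorelSpace.{v}}
    (f : A.Quot → B.Quot) :
    IsBorelFun f ↔ MeasurableSet {p : A.carrier × B.carrier | f (A.toQuot p.1) = B.toQuot p.2} :=
  Iff.rfl

/-- `g : X → Y` is a lifting of `f : X / E → Y / F`. -/
def IsLifting {A : QuotientBorelSpace.{u}} {B : QuotientBorelSpace.{v}}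
    (f : A.Quot → B.Quot) (g : A.carrier → B.carrier) : Prop :=
  ∀ x, f (A.toQuot x) = B.toQuot (g x)

/-- The product of finitely many quotient Borel spaces. -/
def pi {n : ℕ} (A : Fin n → QuotientBorelSpace.{u}) : QuotientBorelSpace.{u} where
  carrier := ∀ i, (A i).carrier
  rel := @piSetoid _ _ fun i => (A i).rel
  measurableSet_rel := by
    have h : {p : (∀ i, (A i).carrier) × (∀ i, (A i).carrier) |
        (@piSetoid _ _ fun i => (A i).rel) p.1 p.2} =
        ⋂ i, (fun p : (∀ i, (A i).carrier) × (∀ i, (A i).carrier) => (p.1 i, p.2 i)) ⁻¹'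
          {p | (A i).rel p.1 p.2} := by
      ext p
      simp only [Set.mem_iInter]
      exact Iff.rfl
    rw [h]
    refine MeasurableSet.iInter fun i => ?_
    have hm : Measurable fun p : (∀ i, (A i).carrier) × (∀ i, (A i).carrier) =>
        (p.1 i, p.2 i) := by fun_prop
    exact hm (A i).measurableSet_rel
  countable_class := fun x => Set.countable_pi fun i => (A i).countable_class (x i)

/-- The identification of the underlying set of a finite product with the product of the
underlying sets; its `i`-th component sends the class of `x` to the class of `x i`. -/
noncomputable def piEquiv {n : ℕ} (A : Fin n → QuotientBorelSpace.{u}) :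
    (pi A).Quot ≃ ∀ i, (A i).Quot :=
  (Setoid.piQuotientEquiv fun i => (A i).rel).symm

/-- The `i`-th projection of a finite product. -/
noncomputable def proj {n : ℕ} (A : Fin n → QuotientBorelSpace.{u}) (i : Fin n) :
    (pi A).Quot → (A i).Quot :=
  fun q => piEquiv A q i

/-- The `n`-tuple `(f₁, …, fₙ)` as a function into the finite product. -/
noncomputable def tuple {n : ℕ} {A : Fin n → QuotientBorelSpace.{u}} {B : QuotientBorelSpace.{v}}
    (f : ∀ i, B.Quot → (A i).Quot) : B.Quot → (pi A).Quot :=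
  fun b => (piEquiv A).symm fun i => f i b

theorem proj_toQuot {n : ℕ} (A : Fin n → QuotientBorelSpace.{u}) (i : Fin n) (x : (pi A).carrier) :
    proj A i ((pi A).toQuot x) = (A i).toQuot (x i) :=
  rfl

/-- The type of Borel functions from `A` to `B`. -/
structure BorelMap (A : QuotientBorelSpace.{u}) (B : QuotientBorelSpace.{v}) where
  toFun : A.Quot → B.Quot
  isBorelFun : IsBorelFun toFun

instance (A : QuotientBorelSpace.{u}) (B : QuotientBorelSpace.{v}) :
    FunLike (BorelMap A B) A.Quot B.Quot where
  coe := BorelMap.toFun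
  coe_injective f g h := by
    cases f
    cases g
    congr

end QuotientBorelSpace

/-! A Borel lifting of `f` is a Borel section of the first projection from its graph, read in the
second coordinate. That projection is countable-to-one because classes are countable, so
Lusin–Novikov (`isSigmaInjOn_univ`) supplies the section. Conversely, a Borel lifting exhibits the
graph as a Borel preimage of the relation. Composites, projections and tuples are then handled on
liftings.

For Lusin–Novikov, make `p` continuous and choose a Borel `B` with σ-injective complement such that
removing a further σ-injective Borel set never stops a finite family of basic open sets from meeting
a common fibre inside `B`. If `B` is nonempty, analytic separation
(`exists_measurableSet_injOn_superset`) lets each member of such a family be split in two, and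
iterating gives a Cantor scheme whose branches all lie in one fibre, which is then uncountable. -/

namespace MeasureTheory

open Set TopologicalSpace Topology Filter

/-- The members of `𝓛` meet a common fibre of `p` inside `B`. -/
def MeetCommonFiber {Z : Type u} {X : Type v} (p : Z → X) (B : Set Z) (𝓛 : Set (Set Z)) : Prop :=
  ∃ x, ∀ U ∈ 𝓛, x ∈ p '' (U ∩ B)

/-- `S` is covered by countably many measurable sets on which `p` is injective. -/
def IsSigmaInjOn {Z : Type u} {X : Type v} [MeasurableSpace Z] (p : Z → X) (S : Set Z) : Prop :=
  ∃ D : ℕ → Set Z, (∀ n, MeasurableSet (D n)) ∧ (∀ n, InjOn p (D n)) ∧ S ⊆ ⋃ n, D n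

/-! ### The σ-ideal of σ-injective sets -/

section SigmaInjOn

variable {Z : Type u} {X : Type v} [MeasurableSpace Z] {p : Z → X}

theorem IsSigmaInjOn.mono {S T : Set Z} (hT : IsSigmaInjOn p T) (h : S ⊆ T) :
    IsSigmaInjOn p S := by
  obtain ⟨D, hm, hi, hc⟩ := hT
  exact ⟨D, hm, hi, h.trans hc⟩

theorem IsSigmaInjOn.empty : IsSigmaInjOn p ∅ :=
  ⟨fun _ => ∅, fun _ => .empty, fun _ => injOn_empty p, empty_subset _⟩

theorem IsSigmaInjOn.of_injOn {D : Set Z} (hD : MeasurableSet D) (h : InjOn p D) :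
    IsSigmaInjOn p D :=
  ⟨fun _ => D, fun _ => hD, fun _ => h, fun _ hz => mem_iUnion.2 ⟨0, hz⟩⟩

theorem IsSigmaInjOn.iUnion {ι : Type*} [Countable ι] {S : ι → Set Z}
    (h : ∀ i, IsSigmaInjOn p (S i)) : IsSigmaInjOn p (⋃ i, S i) := by
  cases isEmpty_or_nonempty ι
  · simpa using IsSigmaInjOn.empty
  choose D hm hi hc using h
  obtain ⟨e, he⟩ := exists_surjective_nat (ι × ℕ)
  refine ⟨fun n => D (e n).1 (e n).2, fun n => hm _ _, fun n => hi _ _,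
    iUnion_subset fun i z hz => ?_⟩
  obtain ⟨k, hk⟩ := mem_iUnion.1 (hc i hz)
  obtain ⟨n, hn⟩ := he (i, k)
  exact mem_iUnion.2 ⟨n, by rwa [hn]⟩

theorem IsSigmaInjOn.union {S T : Set Z} (hS : IsSigmaInjOn p S) (hT : IsSigmaInjOn p T) :
    IsSigmaInjOn p (S ∪ T) := by
  rw [union_eq_iUnion]
  exact IsSigmaInjOn.iUnion (by rintro (_ | _) <;> assumption)

/-- Among the measurable sets with `σ`-injective complement, there is one meeting as few of
countably many given families as possible. -/
theorem exists_isSigmaInjOn_compl_forall_meetCommonFiber {ι : Type*} [Countable ι] (p : Z → X)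
    (𝓛 : ι → Set (Set Z)) :
    ∃ B : Set Z, MeasurableSet B ∧ IsSigmaInjOn p Bᶜ ∧
      ∀ B' : Set Z, MeasurableSet B' → IsSigmaInjOn p B'ᶜ →
        ∀ i, MeetCommonFiber p B (𝓛 i) → MeetCommonFiber p B' (𝓛 i) := by
  classical
  have key : ∀ i, ∃ B : Set Z, MeasurableSet B ∧ IsSigmaInjOn p Bᶜ ∧
      ∀ B' : Set Z, MeasurableSet B' → IsSigmaInjOn p B'ᶜ →
        MeetCommonFiber p B (𝓛 i) → MeetCommonFiber p B' (𝓛 i) := by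
    intro i
    by_cases h : ∃ B : Set Z, MeasurableSet B ∧ IsSigmaInjOn p Bᶜ ∧ ¬ MeetCommonFiber p B (𝓛 i)
    · obtain ⟨B, hB, hs, hn⟩ := h
      exact ⟨B, hB, hs, fun _ _ _ hc => absurd hc hn⟩
    · push Not at h
      exact ⟨univ, .univ, by simpa using IsSigmaInjOn.empty, fun B' hB' hs _ => h B' hB' hs⟩
  choose B hB hs hmin using key
  -- Intersecting the optimal sets handles all families at once; countability of `ι` keeps the
  -- complement σ-injective.
  refine ⟨⋂ i, B i, .iInter hB, ?_, fun B' hB' hs' i ⟨x, hx⟩ => hmin i B' hB' hs' ⟨x, ?_⟩⟩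
  · rw [compl_iInter]
    exact IsSigmaInjOn.iUnion hs
  · exact fun U hU => image_mono (inter_subset_inter_right U (iInter_subset B i)) (hx U hU)

end SigmaInjOn

/-- A set on which `p` is injective is contained in a measurable such set, if the images of its
relatively open subsets are analytic. -/
theorem exists_measurableSet_injOn_superset {Z : Type u} {X : Type v} [TopologicalSpace Z]
    [T2Space Z] [SecondCountableTopology Z] [MeasurableSpace Z] [OpensMeasurableSpace Z]
    [TopologicalSpace X] [T2Space X] [MeasurableSpace X] [OpensMeasurableSpace X]
    {p : Z → X} (hp : Measurable p) {A : Set Z} (hA : InjOn p A)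
    (hA' : ∀ U, IsOpen U → AnalyticSet (p '' (A ∩ U))) :
    ∃ D, A ⊆ D ∧ MeasurableSet D ∧ InjOn p D := by
  let I := {q : countableBasis Z × countableBasis Z // Disjoint (q.1 : Set Z) q.2}
  have hopen : ∀ U : countableBasis Z, IsOpen (U : Set Z) := fun U => isOpen_of_mem_countableBasis U.2
  have : ∀ q : I, MeasurablySeparable (p '' (A ∩ q.1.1)) (p '' (A ∩ q.1.2)) := fun q => by
    refine (hA' _ (hopen _)).measurablySeparable (hA' _ (hopen _)) ?_
    rw [Set.disjoint_left]
    rintro _ ⟨z, ⟨hz, hz1⟩, rfl⟩ ⟨w, ⟨hw, hw2⟩, hwz⟩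
    obtain rfl := hA hw hz hwz
    exact Set.disjoint_left.1 q.2 hz1 hw2
  choose S hS1 hS2 hS using this
  -- Points in the first set of a pair must map into `S q`, points in the second outside it; so two
  -- distinct points of one fibre cannot both survive.
  refine ⟨⋂ q : I, (((q.1.1 : Set Z)ᶜ ∪ p ⁻¹' S q) ∩ ((q.1.2 : Set Z)ᶜ ∪ (p ⁻¹' S q)ᶜ)), ?_, ?_, ?_⟩
  · intro z hz
    refine mem_iInter.2 fun q => ⟨?_, ?_⟩
    · by_cases h : z ∈ (q.1.1 : Set Z)
      · exact Or.inr (hS1 q ⟨z, ⟨hz, h⟩, rfl⟩)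
      · exact Or.inl h
    · by_cases h : z ∈ (q.1.2 : Set Z)
      · exact Or.inr fun h' => Set.disjoint_left.1 (hS2 q) ⟨z, ⟨hz, h⟩, rfl⟩ h'
      · exact Or.inl h
  · refine .iInter fun q => ?_
    exact ((hopen _).measurableSet.compl.union (hp (hS q))).inter
      ((hopen _).measurableSet.compl.union (hp (hS q)).compl)
  · intro z hz w hw hzw
    by_contra hne
    obtain ⟨U, V, hU, hV, hzU, hwV, hUV⟩ := t2_separation hne
    obtain ⟨U', hU', hzU', hUU'⟩ := (isBasis_countableBasis Z).exists_subset_of_mem_open hzU hU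
    obtain ⟨V', hV', hwV', hVV'⟩ := (isBasis_countableBasis Z).exists_subset_of_mem_open hwV hV
    let q : I := ⟨(⟨U', hU'⟩, ⟨V', hV'⟩), hUV.mono hUU' hVV'⟩
    have h1 := (mem_iInter.1 hz q).1.resolve_left fun h => h hzU'
    have h2 := (mem_iInter.1 hw q).2.resolve_left fun h => h hwV'
    exact h2 (by simpa [hzw] using h1)

/-! ### Splitting families and the Cantor scheme -/

section Splitting

variable {Z : Type u} {X : Type v} [MetricSpace Z] [CompleteSpace Z] [SecondCountableTopology Z]
  [MeasurableSpace Z] [BorelSpace Z] [TopologicalSpace X] [PolishSpace X] [MeasurableSpace X]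
  [BorelSpace X]

theorem exists_mem_countableBasis_small {Z : Type u} [MetricSpace Z] [SecondCountableTopology Z]
    {U : Set Z} (hU : IsOpen U) {z : Z} (hz : z ∈ U)
    {ε : ENNReal} (hε : 0 < ε) :
    ∃ V ∈ countableBasis Z, z ∈ V ∧ closure V ⊆ U ∧ Metric.ediam V ≤ ε := by
  have hN : U ∩ Metric.eball z (ε / 2) ∈ 𝓝 z :=
    inter_mem (hU.mem_nhds hz) (Metric.eball_mem_nhds z (ENNReal.half_pos hε.ne'))
  obtain ⟨C, hC, hCc, hCU⟩ := exists_mem_nhds_isClosed_subset hN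
  obtain ⟨V, hV, hzV, hVC⟩ := (isBasis_countableBasis Z).mem_nhds_iff.1 hC
  refine ⟨V, hV, hzV, (closure_minimal hVC hCc).trans (hCU.trans inter_subset_left), ?_⟩
  calc Metric.ediam V ≤ Metric.ediam (Metric.eball z (ε / 2)) :=
        Metric.ediam_mono (hVC.trans (hCU.trans inter_subset_right))
    _ ≤ 2 * (ε / 2) := Metric.ediam_eball_le
    _ = ε := ENNReal.mul_div_cancel (by simp) (by simp)

/-- If `B` is minimal in the sense of `exists_isSigmaInjOn_compl_forall_meetCommonFiber`, any
member of a finite family meeting a common fibre can be split. -/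
theorem MeetCommonFiber.split {p : Z → X} (hp : Measurable p) {B : Set Z} (hB : MeasurableSet B)
    (hBs : IsSigmaInjOn p Bᶜ) {𝓛 : Set (Set Z)} (h𝓛 : 𝓛.Finite) (hb : 𝓛 ⊆ countableBasis Z)
    (hmin : ∀ B' : Set Z, MeasurableSet B' → IsSigmaInjOn p B'ᶜ → MeetCommonFiber p B' 𝓛)
    {U : Set Z} (hU : U ∈ 𝓛) {ε : ENNReal} (hε : 0 < ε) :
    ∃ V ∈ countableBasis Z, ∃ W ∈ countableBasis Z,
      closure V ⊆ U ∧ closure W ⊆ U ∧ Metric.ediam V ≤ ε ∧ Metric.ediam W ≤ ε ∧ Disjoint V W ∧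
      MeetCommonFiber p B (insert V (insert W 𝓛)) := by
  have hopen : ∀ U ∈ 𝓛, IsOpen U := fun U hU => isOpen_of_mem_countableBasis (hb hU)
  set Q : Set X := ⋂ W : 𝓛, p '' ((W : Set Z) ∩ B)
  have hQa : AnalyticSet Q := by
    have : Nonempty 𝓛 := ⟨⟨U, hU⟩⟩
    have : Countable 𝓛 := h𝓛.countable
    exact AnalyticSet.iInter fun W => ((hopen _ W.2).measurableSet.inter hB).analyticSet_image hp
  -- `A` collects the candidates in `U` whose fibre meets the whole family inside `B`; two of them
  -- in one fibre give the split.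
  set A : Set Z := U ∩ B ∩ p ⁻¹' Q with hA
  by_cases hinj : InjOn p A
  · exfalso
    obtain ⟨D, hAD, hD, hDi⟩ := exists_measurableSet_injOn_superset hp hinj fun V hV => by
      have : p '' (A ∩ V) = ⋂ b : Bool, cond b (p '' (U ∩ B ∩ V)) Q := by
        rw [← inter_eq_iInter, ← image_inter_preimage, hA]
        congr 1
        ext z
        simp only [mem_inter_iff]
        tauto
      rw [this]
      refine AnalyticSet.iInter ?_
      rintro (_ | _)
      · exact hQa
      · exact (((hopen U hU).measurableSet.inter hB).inter hV.measurableSet).analyticSet_image hp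
    -- By minimality the family still meets a common fibre inside `B \ D`, but the witness in `U`
    -- belongs to `A ⊆ D`.
    obtain ⟨x, hx⟩ := hmin (B \ D) (hB.diff hD) <|
      (hBs.union (.of_injOn hD hDi)).mono (by
          intro z; simp only [mem_compl_iff, Set.mem_sdiff, mem_union]; tauto)
    obtain ⟨z, ⟨hzU, hzB, hzD⟩, rfl⟩ := hx U hU
    refine hzD (hAD ⟨⟨hzU, hzB⟩, mem_iInter.2 fun W => ?_⟩)
    exact image_mono (inter_subset_inter_right _ sdiff_subset) (hx W W.2)
  · simp only [InjOn, not_forall] at hinj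
    obtain ⟨z, hz, w, hw, hzw, hne⟩ := hinj
    obtain ⟨V, W, hV, hW, hzV, hwW, hVW⟩ := t2_separation hne
    obtain ⟨V', hV', hzV', hVV', hdV⟩ :=
      exists_mem_countableBasis_small (hV.inter (hopen U hU)) ⟨hzV, hz.1.1⟩ hε
    obtain ⟨W', hW', hwW', hWW', hdW⟩ :=
      exists_mem_countableBasis_small (hW.inter (hopen U hU)) ⟨hwW, hw.1.1⟩ hε
    refine ⟨V', hV', W', hW', hVV'.trans inter_subset_right, hWW'.trans inter_subset_right, hdV, hdW,
      hVW.mono (subset_closure.trans (hVV'.trans inter_subset_left))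
        (subset_closure.trans (hWW'.trans inter_subset_left)), p z, ?_⟩
    rintro T (rfl | rfl | hT)
    · exact ⟨z, ⟨hzV', hz.1.2⟩, rfl⟩
    · exact ⟨w, ⟨hwW', hw.1.2⟩, hzw.symm⟩
    · exact mem_iInter.1 hz.2 ⟨T, hT⟩

/-- One level of the splitting: all members of a finite family are split simultaneously. -/
theorem MeetCommonFiber.splitAll {p : Z → X} (hp : Measurable p) {B : Set Z} (hB : MeasurableSet B)
    (hBs : IsSigmaInjOn p Bᶜ)
    (hmin : ∀ 𝓛 : Set (Set Z), 𝓛.Finite → 𝓛 ⊆ countableBasis Z → MeetCommonFiber p B 𝓛 →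
      ∀ B' : Set Z, MeasurableSet B' → IsSigmaInjOn p B'ᶜ → MeetCommonFiber p B' 𝓛)
    {𝓛 : Set (Set Z)} (hf : 𝓛.Finite) (hb : 𝓛 ⊆ countableBasis Z) (h : MeetCommonFiber p B 𝓛)
    {ε : ENNReal} (hε : 0 < ε) :
    ∃ 𝓜 : Set (Set Z), 𝓜.Finite ∧ 𝓜 ⊆ countableBasis Z ∧ MeetCommonFiber p B 𝓜 ∧ 𝓛 ⊆ 𝓜 ∧
      ∀ U ∈ 𝓛, ∃ V ∈ 𝓜, ∃ W ∈ 𝓜, closure V ⊆ U ∧ closure W ⊆ U ∧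
        Metric.ediam V ≤ ε ∧ Metric.ediam W ≤ ε ∧ Disjoint V W := by
  -- Induction on the part `𝓢` already split; keeping all of `𝓛` in `𝓜` leaves the other members
  -- available.
  refine Set.Finite.induction_on_subset (motive := fun 𝓢 _ => ∃ 𝓜 : Set (Set Z), 𝓜.Finite ∧
      𝓜 ⊆ countableBasis Z ∧ MeetCommonFiber p B 𝓜 ∧ 𝓛 ⊆ 𝓜 ∧
      ∀ U ∈ 𝓢, ∃ V ∈ 𝓜, ∃ W ∈ 𝓜, closure V ⊆ U ∧ closure W ⊆ U ∧
        Metric.ediam V ≤ ε ∧ Metric.ediam W ≤ ε ∧ Disjoint V W) 𝓛 hf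
    ⟨𝓛, hf, hb, h, Subset.rfl, by simp⟩ ?_
  rintro U 𝓢 hU - - ⟨𝓜, hMf, hMb, hM, hLM, hsplit⟩
  obtain ⟨V, hV, W, hW, hVU, hWU, hdV, hdW, hVW, hm⟩ :=
    MeetCommonFiber.split hp hB hBs hMf hMb (hmin 𝓜 hMf hMb hM) (hLM hU) hε
  have hsub : 𝓜 ⊆ insert V (insert W 𝓜) := (subset_insert _ _).trans (subset_insert _ _)
  refine ⟨insert V (insert W 𝓜), (hMf.insert W).insert V,
    insert_subset hV (insert_subset hW hMb), hm, hLM.trans hsub, ?_⟩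
  rintro T (rfl | hT)
  · exact ⟨V, mem_insert _ _, W, mem_insert_of_mem _ (mem_insert _ _), hVU, hWU, hdV, hdW, hVW⟩
  · obtain ⟨V', hV', W', hW', h'⟩ := hsplit T hT
    exact ⟨V', hsub hV', W', hsub hW', h'⟩

open CantorScheme in
/-- A Cantor scheme all of whose finite parts meet a common fibre yields an uncountable fibre. -/
theorem exists_not_countable_fiber_of_splitting {Z : Type u} {X : Type v} [MetricSpace Z]
    [CompleteSpace Z] [TopologicalSpace X] [T2Space X] {p : Z → X} (hp : Continuous p) {B : Set Z}
    (L : ℕ → Set (Set Z)) (hL : ∀ n, MeetCommonFiber p B (L n)) (hne : (L 0).Nonempty)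
    {ε : ℕ → ENNReal} (hε : Tendsto ε atTop (𝓝 0))
    (hsplit : ∀ n, ∀ U ∈ L n, ∃ V ∈ L (n + 1), ∃ W ∈ L (n + 1), closure V ⊆ U ∧ closure W ⊆ U ∧
        Metric.ediam V ≤ ε n ∧ Metric.ediam W ≤ ε n ∧ Disjoint V W) :
    ∃ x, ¬ (p ⁻¹' {x}).Countable := by
  choose V hV W hW hVU hWU hdV hdW hVW using hsplit
  let D : (l : List Bool) → {U // U ∈ L l.length} := fun l => by
    induction l with
    | nil => exact ⟨hne.some, hne.some_mem⟩
    | cons a l ih => exact cond a ⟨V _ ih.1 ih.2, hV _ _ _⟩ ⟨W _ ih.1 ih.2, hW _ _ _⟩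
  let S : List Bool → Set Z := fun l => (D l).1
  have hanti : ClosureAntitone S := by
    rintro l (_ | _)
    · exact hWU _ _ (D l).2
    · exact hVU _ _ (D l).2
  have hdisj : CantorScheme.Disjoint S := by
    rintro l (_ | _) (_ | _) hab <;> try contradiction
    · exact (hVW _ _ (D l).2).symm
    · exact hVW _ _ (D l).2
  have hdiam : VanishingDiam S := by
    intro x
    -- The root carries no diameter bound; level `n + 1` is bounded by `ε n`.
    rw [← tendsto_add_atTop_iff_nat 1]
    refine tendsto_of_tendsto_of_tendsto_of_le_of_le tendsto_const_nhds hε (fun _ => zero_le) ?_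
    intro n
    have hlen : (PiNat.res x n).length = n := PiNat.res_length x n
    have : Metric.ediam (S (x n :: PiNat.res x n)) ≤ ε (PiNat.res x n).length := by
      cases x n
      · exact hdW _ _ (D _).2
      · exact hdV _ _ (D _).2
    rwa [hlen] at this
  have hnon : ∀ l, (S l).Nonempty := fun l => by
    obtain ⟨x, hx⟩ := hL l.length
    obtain ⟨z, hz, -⟩ := hx _ (D l).2
    exact ⟨z, hz.1⟩
  have hdom := hanti.map_of_vanishingDiam hdiam hnon
  let φ : (ℕ → Bool) → Z := fun a => (inducedMap S).2 ⟨a, hdom ▸ mem_univ a⟩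
  have hφ : Function.Injective φ := fun a b hab => by
    simpa using hdisj.map_injective hab
  have hmem : ∀ a n, φ a ∈ S (PiNat.res a n) := fun a n => map_mem _ n
  have hlim : ∀ a (z : ℕ → Z), (∀ n, z n ∈ S (PiNat.res a n)) → Tendsto z atTop (𝓝 (φ a)) := by
    intro a z hz
    rw [tendsto_iff_edist_tendsto_0]
    exact tendsto_of_tendsto_of_tendsto_of_le_of_le tendsto_const_nhds (hdiam a)
      (fun _ => zero_le) fun n => Metric.edist_le_ediam_of_mem (hz n) (hmem a n)
  -- With `x n` the base point of a fibre common to level `n`, points over `x n` along any branch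
  -- `c` converge to `φ c`; hence `x` tends to every `p (φ c)`.
  have hconst : ∀ a b, p (φ a) = p (φ b) := by
    intro a b
    choose x hx using hL
    have hin : ∀ (c : ℕ → Bool) n, ∃ z, z ∈ S (PiNat.res c n) ∧ p z = x n := fun c n => by
      have hlen : (PiNat.res c n).length = n := PiNat.res_length c n
      obtain ⟨z, hz, hpz⟩ := hx n (S (PiNat.res c n)) (by
        have : S (PiNat.res c n) ∈ L (PiNat.res c n).length := (D (PiNat.res c n)).2
        rwa [hlen] at this)
      exact ⟨z, hz.1, hpz⟩
    have hx' : ∀ c, Tendsto x atTop (𝓝 (p (φ c))) := fun c => by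
      choose z hz hpz using hin c
      simpa only [Function.comp_def, hpz] using (hp.tendsto (φ c)).comp (hlim c z hz)
    exact tendsto_nhds_unique (hx' a) (hx' b)
  refine ⟨p (φ fun _ => false), fun hc => ?_⟩
  have : (range φ).Countable := hc.mono (by rintro _ ⟨a, rfl⟩; exact hconst _ _)
  have h2 : Countable (ℕ → Bool) := by
    have := this.to_subtype
    exact (Set.rangeFactorization_injective.2 hφ).countable
  obtain ⟨e, he⟩ := exists_surjective_nat (ℕ → Bool)
  obtain ⟨n, hn⟩ := he fun k => !(e k k)
  simpa using congr_fun hn n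

/-- Either the minimal `B` is empty, and its complement is everything, or a basic neighbourhood of a
point of `B` starts the splitting. -/
theorem isSigmaInjOn_univ_of_continuous {p : Z → X} (hp : Continuous p)
    (hc : ∀ x, (p ⁻¹' {x}).Countable) : IsSigmaInjOn p univ := by
  obtain ⟨B, hB, hBs, hmin'⟩ := exists_isSigmaInjOn_compl_forall_meetCommonFiber p
    fun 𝓕 : Finset (countableBasis Z) => ((↑) '' (𝓕 : Set (countableBasis Z)) : Set (Set Z))
  have hmin : ∀ 𝓛 : Set (Set Z), 𝓛.Finite → 𝓛 ⊆ countableBasis Z → MeetCommonFiber p B 𝓛 →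
      ∀ B' : Set Z, MeasurableSet B' → IsSigmaInjOn p B'ᶜ → MeetCommonFiber p B' 𝓛 := by
    intro 𝓛 hf hb h B' hB' hs'
    have hf' : ((↑) ⁻¹' 𝓛 : Set (countableBasis Z)).Finite := hf.preimage Subtype.val_injective.injOn
    have := hmin' B' hB' hs' hf'.toFinset
    rw [hf'.coe_toFinset, Subtype.image_preimage_coe, inter_eq_right.2 hb] at this
    exact this h
  rcases B.eq_empty_or_nonempty with rfl | ⟨z, hz⟩
  · simpa using hBs
  exfalso
  obtain ⟨U, hU, hzU, -⟩ :=
    (isBasis_countableBasis Z).exists_subset_of_mem_open (mem_univ z) isOpen_univ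
  obtain ⟨ε, -, hε0, hε⟩ := exists_seq_strictAnti_tendsto' (zero_lt_one' ENNReal)
  let P := {𝓛 : Set (Set Z) // 𝓛.Finite ∧ 𝓛 ⊆ countableBasis Z ∧ MeetCommonFiber p B 𝓛}
  have step : ∀ (n : ℕ) (𝓛 : P), ∃ 𝓜 : P, 𝓛.1 ⊆ 𝓜.1 ∧
      ∀ U ∈ 𝓛.1, ∃ V ∈ 𝓜.1, ∃ W ∈ 𝓜.1, closure V ⊆ U ∧ closure W ⊆ U ∧
        Metric.ediam V ≤ ε n ∧ Metric.ediam W ≤ ε n ∧ Disjoint V W := by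
    rintro n ⟨𝓛, hf, hb, h⟩
    obtain ⟨𝓜, h1, h2, h3, h4⟩ :=
      MeetCommonFiber.splitAll hp.measurable hB hBs hmin hf hb h (hε0 n).1
    exact ⟨⟨𝓜, h1, h2, h3⟩, h4⟩
  choose N hN hNs using step
  let L : ℕ → P := fun n => Nat.rec ⟨{U}, finite_singleton U, by simpa using hU, p z, by
    rintro _ rfl; exact ⟨z, ⟨hzU, hz⟩, rfl⟩⟩ N n
  obtain ⟨x, hx⟩ := exists_not_countable_fiber_of_splitting hp (fun n => (L n).1)
    (fun n => (L n).2.2.2) (singleton_nonempty U) hε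
    fun n => hNs n (L n)
  exact hx (hc x)

end Splitting

/-! ### Lusin–Novikov uniformization -/

/-- **Lusin–Novikov**: a countable-to-one Borel map between standard Borel spaces is injective on
each of countably many Borel sets covering its domain. -/
theorem isSigmaInjOn_univ {Z : Type u} {X : Type v} [MeasurableSpace Z] [StandardBorelSpace Z]
    [MeasurableSpace X] [StandardBorelSpace X] {p : Z → X} (hp : Measurable p)
    (hc : ∀ x, (p ⁻¹' {x}).Countable) : IsSigmaInjOn p univ := by
  let tZ := upgradeStandardBorel Z
  let := upgradeStandardBorel X
  -- A finer Polish topology makes `p` continuous without changing the Borel sets.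
  obtain ⟨t', hle, hpc, hpol⟩ := hp.exists_continuous
  have hb : @BorelSpace Z t' _ := by
    refine @BorelSpace.mk Z t' _ ?_
    rw [borel_eq_borel_of_le hpol tZ.toPolishSpace hle]
    exact BorelSpace.measurable_eq
  clear hle
  let := t'
  let := upgradeIsCompletelyMetrizable Z
  exact isSigmaInjOn_univ_of_continuous hpc hc

/-- A countable-to-one Borel surjection between standard Borel spaces has a Borel section. -/
theorem exists_measurable_rightInverse {Z : Type u} {X : Type v} [MeasurableSpace Z]
    [StandardBorelSpace Z] [MeasurableSpace X] [StandardBorelSpace X] {p : Z → X}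
    (hp : Measurable p) (hs : Function.Surjective p) (hc : ∀ x, (p ⁻¹' {x}).Countable) :
    ∃ s : X → Z, Measurable s ∧ Function.RightInverse s p := by
  classical
  obtain ⟨D, hD, hi, hcov⟩ := isSigmaInjOn_univ hp hc
  have hex : ∀ x, ∃ n, x ∈ p '' D n := fun x => by
    obtain ⟨z, rfl⟩ := hs x
    obtain ⟨n, hn⟩ := mem_iUnion.1 (hcov (mem_univ z))
    exact ⟨n, z, hn, rfl⟩
  choose s hsD hsp using fun x => Nat.find_spec (hex x)
  refine ⟨s, fun T hT => ?_, hsp⟩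
  -- `s x` is the only point over `x` in the first `D n` meeting its fibre; injective Borel images
  -- are Borel.
  have : s ⁻¹' T = ⋃ n, p '' (D n ∩ T) ∩ ⋂ m : Fin n, (p '' D m)ᶜ := by
    ext x
    simp only [mem_preimage, mem_iUnion, mem_inter_iff, mem_iInter, mem_compl_iff]
    constructor
    · exact fun h => ⟨Nat.find (hex x), ⟨s x, ⟨hsD x, h⟩, hsp x⟩, fun m => Nat.find_min (hex x) m.2⟩
    · rintro ⟨n, ⟨z, ⟨hzD, hzT⟩, rfl⟩, hm⟩
      have hn : Nat.find (hex (p z)) = n :=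
        (Nat.find_eq_iff _).2 ⟨⟨z, hzD, rfl⟩, fun m hmn => hm ⟨m, hmn⟩⟩
      have h1 := hsD (p z)
      rw [hn] at h1
      rwa [hi n h1 hzD (hsp _)]
  rw [this]
  refine .iUnion fun n => .inter ?_ (.iInter fun m => ?_)
  · exact ((hD n).inter hT).image_of_measurable_injOn hp ((hi n).mono inter_subset_left)
  · exact ((hD m).image_of_measurable_injOn hp (hi m)).compl

end MeasureTheory

/-! ### Liftings of Borel functions -/

namespace QuotientBorelSpace

theorem toQuot_eq_iff {A : QuotientBorelSpace.{u}} {x y : A.carrier} :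
    A.toQuot x = A.toQuot y ↔ A.rel x y :=
  Quotient.eq

theorem countable_toQuot_eq (A : QuotientBorelSpace.{u}) (q : A.Quot) :
    {y | q = A.toQuot y}.Countable := by
  obtain ⟨x, rfl⟩ := Quotient.exists_rep q
  exact (A.countable_class x).mono fun y hy => toQuot_eq_iff.1 hy

theorem IsLifting.isBorelFun {A : QuotientBorelSpace.{u}} {B : QuotientBorelSpace.{v}}
    {f : A.Quot → B.Quot} {g : A.carrier → B.carrier} (h : IsLifting f g) (hg : Measurable g) :
    IsBorelFun f := by
  rw [isBorelFun_iff]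
  have hm : Measurable fun p : A.carrier × B.carrier => (g p.1, p.2) := by fun_prop
  convert! hm B.measurableSet_rel using 1
  ext p
  simp only [Set.mem_ofPred_eq, Set.mem_preimage, h p.1, toQuot_eq_iff]

theorem IsBorelFun.exists_isLifting {A : QuotientBorelSpace.{u}} {B : QuotientBorelSpace.{v}}
    {f : A.Quot → B.Quot} (hf : IsBorelFun f) :
    ∃ g : A.carrier → B.carrier, Measurable g ∧ IsLifting f g := by
  rw [isBorelFun_iff] at hf
  have := hf.standardBorel
  have hp : Measurable fun z : {p : A.carrier × B.carrier | f (A.toQuot p.1) = B.toQuot p.2} =>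
    z.1.1 := by fun_prop
  obtain ⟨s, hs, hsp⟩ := MeasureTheory.exists_measurable_rightInverse hp
    (fun x => by
      obtain ⟨y, hy⟩ := Quotient.exists_rep (f (A.toQuot x))
      exact ⟨⟨(x, y), hy.symm⟩, rfl⟩)
    (fun x => by
      -- The second coordinate embeds the fibre over `x` into a single class.
      refine Set.MapsTo.countable_of_injOn (f := fun z => z.1.2) ?_ ?_
        (B.countable_toQuot_eq (f (A.toQuot x)))
      · rintro z rfl
        exact z.2
      · rintro z hz z' hz' h
        exact Subtype.ext (Prod.ext (hz.trans hz'.symm) h))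
  refine ⟨fun x => (s x).1.2, by fun_prop, fun x => ?_⟩
  have h : (s x).1.1 = x := hsp x
  rw [← (s x).2, h]

theorem isBorelFun_iff_exists_isLifting {A : QuotientBorelSpace.{u}} {B : QuotientBorelSpace.{v}}
    {f : A.Quot → B.Quot} :
    IsBorelFun f ↔ ∃ g : A.carrier → B.carrier, Measurable g ∧ IsLifting f g :=
  ⟨IsBorelFun.exists_isLifting, fun ⟨_, hg, h⟩ => h.isBorelFun hg⟩

theorem isBorelFun_id (A : QuotientBorelSpace.{u}) : IsBorelFun (id : A.Quot → A.Quot) :=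
  IsLifting.isBorelFun (g := id) (fun _ => rfl) measurable_id

theorem IsBorelFun.comp {A : QuotientBorelSpace.{u}} {B : QuotientBorelSpace.{v}}
    {C : QuotientBorelSpace.{w}} {g : B.Quot → C.Quot} {f : A.Quot → B.Quot}
    (hg : IsBorelFun g) (hf : IsBorelFun f) : IsBorelFun (g ∘ f) := by
  obtain ⟨f', hf', hff'⟩ := hf.exists_isLifting
  obtain ⟨g', hg', hgg'⟩ := hg.exists_isLifting
  refine IsLifting.isBorelFun (g := g' ∘ f') (fun x => ?_) (hg'.comp hf')
  rw [Function.comp_apply, hff', hgg', Function.comp_apply]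

theorem isBorelFun_proj {n : ℕ} (A : Fin n → QuotientBorelSpace.{u}) (i : Fin n) :
    IsBorelFun (proj A i) :=
  IsLifting.isBorelFun (A := pi A) (g := fun x => x i) (proj_toQuot A i) (measurable_pi_apply i)

theorem proj_tuple {n : ℕ} {A : Fin n → QuotientBorelSpace.{u}} {B : QuotientBorelSpace.{v}}
    (f : ∀ i, B.Quot → (A i).Quot) (i : Fin n) (b : B.Quot) : proj A i (tuple f b) = f i b :=
  congr_fun ((piEquiv A).apply_symm_apply _) i

theorem proj_ext {n : ℕ} {A : Fin n → QuotientBorelSpace.{u}} {q r : (pi A).Quot}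
    (h : ∀ i, proj A i q = proj A i r) : q = r :=
  (piEquiv A).injective (funext h)

theorem isBorelFun_tuple {n : ℕ} {A : Fin n → QuotientBorelSpace.{u}} {B : QuotientBorelSpace.{v}}
    {f : ∀ i, B.Quot → (A i).Quot} (hf : ∀ i, IsBorelFun (f i)) : IsBorelFun (tuple f) := by
  choose g hg hfg using fun i => (hf i).exists_isLifting
  refine IsLifting.isBorelFun (B := pi A) (g := fun x i => g i x) (fun x => proj_ext fun i => ?_)
    (measurable_pi_iff.2 hg)
  exact (proj_tuple f i _).trans (hfg i x)

/-! ### The category and its finite products -/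

instance largeCategory : LargeCategory QuotientBorelSpace.{u} where
  Hom A B := BorelMap A B
  id A := ⟨id, isBorelFun_id A⟩
  comp f g := ⟨g.toFun ∘ f.toFun, g.isBorelFun.comp f.isBorelFun⟩

instance concreteCategory : ConcreteCategory QuotientBorelSpace.{u} (CC := QuotientBorelSpace.Quot)
    (fun A B : QuotientBorelSpace.{u} => BorelMap A B) where
  hom f := f
  ofHom f := f
  id_apply _ := rfl
  comp_apply _ _ _ := rfl

/-- The fan of projections from a finite product. -/
noncomputable abbrev piFan {n : ℕ} (A : Fin n → QuotientBorelSpace.{u}) : Fan A :=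
  Fan.mk (pi A) fun i => (ConcreteCategory.ofHom
    (⟨proj A i, isBorelFun_proj A i⟩ : BorelMap (pi A) (A i)) : pi A ⟶ A i)

/-- Finite products of quotient Borel spaces are categorical products. -/
noncomputable def isLimitPiFan {n : ℕ} (A : Fin n → QuotientBorelSpace.{u}) :
    IsLimit (piFan A) :=
  Fan.IsLimit.mk _
    (fun s => ConcreteCategory.ofHom (⟨tuple fun i => (s.proj i).toFun,
      isBorelFun_tuple fun i => (s.proj i).isBorelFun⟩ : BorelMap s.pt (pi A)))
    (fun s i => ConcreteCategory.hom_ext _ _ fun b => proj_tuple (fun i => (s.proj i).toFun) i b)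
    (fun s _ hm => ConcreteCategory.hom_ext _ _ fun b => proj_ext fun i =>
      (ConcreteCategory.congr_hom (hm i) b).trans
        (proj_tuple (fun i => (s.proj i).toFun) i b).symm)

instance hasFiniteProducts : HasFiniteProducts QuotientBorelSpace.{u} where
  out n := ⟨fun F =>
    have : HasLimit (Discrete.functor (F.obj ∘ Discrete.mk : Fin n → QuotientBorelSpace.{u})) :=
      ⟨⟨⟨_, isLimitPiFan _⟩⟩⟩
    hasLimit_of_iso Discrete.natIsoFunctor.symm⟩

end QuotientBorelSpace

theorem mainTheorem7 :
    -- existence of liftings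
    (∀ (A : QuotientBorelSpace.{u}) (B : QuotientBorelSpace.{v}) (f : A.Quot → B.Quot),
      QuotientBorelSpace.IsBorelFun f ↔
        ∃ g : A.carrier → B.carrier, Measurable g ∧ QuotientBorelSpace.IsLifting f g) ∧
    -- identities and composites of Borel functions are Borel
    (∀ A : QuotientBorelSpace.{u}, QuotientBorelSpace.IsBorelFun (id : A.Quot → A.Quot)) ∧
    (∀ (A : QuotientBorelSpace.{u}) (B : QuotientBorelSpace.{v}) (C : QuotientBorelSpace.{w})
      (f : A.Quot → B.Quot) (g : B.Quot → C.Quot),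
      QuotientBorelSpace.IsBorelFun f → QuotientBorelSpace.IsBorelFun g →
        QuotientBorelSpace.IsBorelFun (g ∘ f)) ∧
    -- projections from finite products, and tuples of Borel functions, are Borel
    (∀ (n : ℕ) (A : Fin n → QuotientBorelSpace.{u}),
      (∀ i, QuotientBorelSpace.IsBorelFun (QuotientBorelSpace.proj A i)) ∧
      ∀ (B : QuotientBorelSpace.{v}) (f : ∀ i, B.Quot → (A i).Quot),
        (∀ i, QuotientBorelSpace.IsBorelFun (f i)) →
          QuotientBorelSpace.IsBorelFun (QuotientBorelSpace.tuple f)) ∧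
    -- quotient Borel spaces and Borel functions form a concrete category (on the underlying
    -- sets `X / E`), in which the finite products above are categorical products
    (∃ (_ : LargeCategory QuotientBorelSpace.{u})
      (_ : ConcreteCategory QuotientBorelSpace.{u} (CC := QuotientBorelSpace.Quot)
        (fun A B : QuotientBorelSpace.{u} => QuotientBorelSpace.BorelMap A B)),
      (∀ (n : ℕ) (A : Fin n → QuotientBorelSpace.{u}),
        ∃ hproj : ∀ i, QuotientBorelSpace.IsBorelFun (QuotientBorelSpace.proj A i),
          Nonempty (IsLimit (Fan.mk (QuotientBorelSpace.pi A) fun i =>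
            (ConcreteCategory.ofHom
              (⟨QuotientBorelSpace.proj A i, hproj i⟩ :
                QuotientBorelSpace.BorelMap (QuotientBorelSpace.pi A) (A i)) :
              QuotientBorelSpace.pi A ⟶ A i)))) ∧
      HasFiniteProducts QuotientBorelSpace.{u}) :=
  ⟨fun _ _ _ => QuotientBorelSpace.isBorelFun_iff_exists_isLifting,
    QuotientBorelSpace.isBorelFun_id,
    fun _ _ _ _ _ hf hg => hg.comp hf,
    fun _ A => ⟨QuotientBorelSpace.isBorelFun_proj A,
      fun _ _ => QuotientBorelSpace.isBorelFun_tuple⟩,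
    QuotientBorelSpace.largeCategory, QuotientBorelSpace.concreteCategory,
    fun _ A => ⟨QuotientBorelSpace.isBorelFun_proj A, ⟨QuotientBorelSpace.isLimitPiFan A⟩⟩,
    QuotientBorelSpace.hasFiniteProducts⟩
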